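/- For infinite sets $a,b\subseteq\mathbb N$ with increasing enumerations $a(0)<a(1)<\cdots$ and $b(0)<b(1)<\cdots$, write $a\le^* b$ if $a(n)\le b(n)$ for all but finitely many $n$. Let $\mathfrak d$ be the minimal cardinality of a family $D$ of infinite subsets of $\mathbb N$ that is dominating, that is, such that for every infinite $a\subseteq\mathbb N$ there is $x\in D$ with $a\le^* x$. Let $\mathrm{cov}(\mathcal M)$ be the minimal cardinality of a family of meager subsets of $\mathbb R$ whose union is $\mathbb R$. A topological space $X$ is Menger if for each sequence $\mathcal U_1,\mathcal U_2,\dots$ of open covers of $X$ there are finite sets $\mathcal F_1\subseteq\mathcal U_1,\mathcal F_2\subseteq\mathcal U_2,\dots$ such that $\bigcup_n\mathcal F_n$ covers $X$; it is Rothberger if for each such sequence there are $U_1\in\mathcal U_1,U_2\in\mathcal U_2,\dots$ with $X=\bigcup_n U_n$. Assume that $\mathrm{cov}(\mathcal M)=\mathfrak d$. Then there are sets $X,Y\subseteq\mathbb R$ such that $X$ and $Y$, with the subspace topology, are Rothberger, but the product space $X\times Y$ is not Menger. -/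

import Mathlib

open Set Filter
open scoped Cardinal

/-- A family `𝒰` of sets is an open cover of the space `X`. -/
def IsOpenCovering (X : Type*) [TopologicalSpace X] (𝒰 : Set (Set X)) : Prop :=
  (∀ U ∈ 𝒰, IsOpen U) ∧ ⋃₀ 𝒰 = univ

/-- Menger's property: from each sequence of open covers one can choose finite subfamilies
whose union covers the space. -/
def IsMengerSpace (X : Type*) [TopologicalSpace X] : Prop :=
  ∀ 𝒰 : ℕ → Set (Set X), (∀ n, IsOpenCovering X (𝒰 n)) →
    ∃ ℱ : ℕ → Set (Set X), (∀ n, ℱ n ⊆ 𝒰 n ∧ (ℱ n).Finite) ∧ ⋃ n, ⋃₀ ℱ n = univ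

/-- Rothberger's property: from each sequence of open covers one can choose one element of each
cover so that the chosen elements cover the space. -/
def IsRothbergerSpace (X : Type*) [TopologicalSpace X] : Prop :=
  ∀ 𝒰 : ℕ → Set (Set X), (∀ n, IsOpenCovering X (𝒰 n)) →
    ∃ U : ℕ → Set X, (∀ n, U n ∈ 𝒰 n) ∧ ⋃ n, U n = univ

/-- The cardinal `cov(𝓜)`: the minimal cardinality of a cover of the real line by meager sets. -/
noncomputable def covMeager : Cardinal.{0} :=
  sInf {κ | ∃ F : Set (Set ℝ), (∀ A ∈ F, IsMeagre A) ∧ ⋃₀ F = univ ∧ #F = κ}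

/-- The family of infinite sets of natural numbers. -/
abbrev InfiniteNatSet : Type := {a : Set ℕ // a.Infinite}

/-- The increasing enumeration of an infinite set of natural numbers. -/
noncomputable def InfiniteNatSet.enum (a : InfiniteNatSet) (n : ℕ) : ℕ := Nat.nth (fun m => m ∈ a.1) n

/-- `a ≤* b`: the enumerations satisfy `a(n) ≤ b(n)` for all but finitely many `n`. -/
def InfiniteNatSet.LeStar (a b : InfiniteNatSet) : Prop := {n : ℕ | b.enum n < a.enum n}.Finite

/-- A family of infinite sets of natural numbers is dominating if each infinite set is `≤*` some
member of the family. -/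
def IsDominating (D : Set InfiniteNatSet) : Prop := ∀ a : InfiniteNatSet, ∃ x ∈ D, a.LeStar x

/-- The cardinal `𝔡`: the minimal cardinality of a dominating family. -/
noncomputable def dominatingNumber : Cardinal.{0} :=
  sInf {κ | ∃ D : Set InfiniteNatSet, IsDominating D ∧ #D = κ}

/-! Index a dominating family $(d_\alpha)$ by the initial ordinal of $\mathfrak
d=\mathrm{cov}(\mathcal M)$, so that every initial segment has fewer than $\mathrm{cov}(\mathcal M)$
members. A genericity argument (`exists_generic`, `exists_slow_sequence`) gives binary sequences
$x_\alpha$ that never change value twice in $[n,d_\alpha(n)]$, yet for every $\beta\le\alpha$ and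
both values $c$ are constantly $c$ on $[n,d_\beta(n)]$ for infinitely many $n$.

Let $X$ consist of the $x_\alpha$ and $Y$ of their complements, each together with all finite sets.
By compactness, a closed set avoiding the finite sets has a gap bound $b$; once $b\le^* d_\beta$, it
contains no $x_\alpha$ with $\alpha\ge\beta$. Thus fewer than $\mathrm{cov}(\mathcal M)$ points lie
outside any open set containing the finite sets, which implies Rothberger; likewise for $Y$, by the
symmetry in $c$.

In $X\times Y$, the closed set of complementary pairs contains only pairs $(x_\alpha,\neg
x_\alpha)$. Menger's property would yield one $g$ such that each $x_\alpha$ changes twice in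
$[n,g(n)]$ for infinitely many $n$, which fails when $g\le^* d_\alpha$. -/

section

open scoped Topology

/-! ### Category in the real line, transferred to sequences of natural numbers -/

/-- An enumeration of the rational numbers, as reals. -/
noncomputable def ratEnum (n : ℕ) : ℝ := (((Denumerable.eqv ℚ).symm n : ℚ) : ℝ)

/-- A sequence of digits attached to a real number: immediately to the right of the `n`-th rational
the `n`-th digit takes each value on nonempty open intervals, and the earlier digits are
constant. -/
noncomputable def realDigit (n : ℕ) (r : ℝ) : ℕ := (Nat.unpair ⌊-(r - ratEnum n)⁻¹⌋.natAbs).1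

lemma ratEnum_injective : Function.Injective ratEnum := fun m n h => by
  simpa [ratEnum] using h

lemma exists_Ioo_realDigit_eq (n c : ℕ) {ε : ℝ} (hε : 0 < ε) :
    ∃ p q, ratEnum n < p ∧ p < q ∧ q < ratEnum n + ε ∧ ∀ r ∈ Ioo p q, realDigit n r = c := by
  -- On $(1/k,1/(k-1))$ to the right of the rational the floor is $-k$. Pairing $c$ with a large $K$
  -- gives a large $k$ that codes $c$.
  obtain ⟨K, hK⟩ := exists_nat_gt (max 2 (ε⁻¹ + 1))
  have hk : (K : ℝ) ≤ (Nat.pair c K : ℕ) := by exact_mod_cast Nat.right_le_pair c K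
  set k := Nat.pair c K with hkdef
  have h2 : (2 : ℝ) < k := (le_max_left _ _).trans_lt (hK.trans_le hk)
  have h3 : ε⁻¹ + 1 < (k : ℝ) := (le_max_right _ _).trans_lt (hK.trans_le hk)
  have hk1 : (0 : ℝ) < k - 1 := by linarith
  refine ⟨ratEnum n + (k : ℝ)⁻¹, ratEnum n + ((k : ℝ) - 1)⁻¹, ?_, ?_, ?_, ?_⟩
  · have : (0 : ℝ) < (k : ℝ)⁻¹ := by positivity
    linarith
  · have : (k : ℝ)⁻¹ < ((k : ℝ) - 1)⁻¹ := by
      apply inv_strictAnti₀ hk1; linarith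
    linarith
  · have : ((k : ℝ) - 1)⁻¹ < ε := by
      apply inv_lt_of_inv_lt₀ hε; linarith
    linarith
  · rintro r ⟨h4, h5⟩
    have hpos : 0 < r - ratEnum n := by
      have : (0 : ℝ) < (k : ℝ)⁻¹ := by positivity
      linarith
    have h6 : (r - ratEnum n)⁻¹ < k := by
      apply inv_lt_of_inv_lt₀ (by linarith); linarith
    have h7 : (k : ℝ) - 1 < (r - ratEnum n)⁻¹ := by
      rw [lt_inv_comm₀ hk1 hpos]; linarith
    have h8 : ⌊-(r - ratEnum n)⁻¹⌋ = -(k : ℤ) := by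
      rw [Int.floor_eq_iff]; push_cast; constructor <;> linarith
    simp [realDigit, h8, hkdef]

/-- The minus sign makes $-(r-b)^{-1}$ increase with $r$ near $a\ne b$, and the floor is locally
constant to the right of every point. -/
lemma eventually_realDigit_const {j n : ℕ} (h : j ≠ n) :
    ∃ c, ∀ᶠ r in 𝓝[>] ratEnum n, realDigit j r = c := by
  set a := ratEnum n
  set b := ratEnum j
  have hab : a - b ≠ 0 := sub_ne_zero.2 fun e => h (ratEnum_injective e.symm)
  have hcont : Tendsto (fun r : ℝ => -(r - b)⁻¹) (𝓝[>] a) (𝓝 (-(a - b)⁻¹)) := by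
    have : ContinuousAt (fun r : ℝ => -(r - b)⁻¹) a :=
      ((continuousAt_id.sub continuousAt_const).inv₀ hab).neg
    exact this.mono_left nhdsWithin_le_nhds
  have hge : ∀ᶠ r in 𝓝[>] a, -(r - b)⁻¹ ∈ Ici (-(a - b)⁻¹) := by
    have hr : ∀ᶠ r in 𝓝[>] a, r ∈ Ioi a := self_mem_nhdsWithin
    have hsign : ∀ᶠ r in 𝓝[>] a, 0 < (r - b) * (a - b) := by
      have : ContinuousAt (fun r : ℝ => (r - b) * (a - b)) a := by fun_prop
      exact (this.eventually (lt_mem_nhds (mul_self_pos.2 hab))).filter_mono nhdsWithin_le_nhds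
    filter_upwards [hr, hsign] with r hr hs
    have hrb : r - b ≠ 0 := fun e => by simp [e] at hs
    have : (a - b)⁻¹ - (r - b)⁻¹ = (r - a) / ((r - b) * (a - b)) := by
      field_simp; ring
    have h0 : 0 ≤ (r - a) / ((r - b) * (a - b)) :=
      div_nonneg (sub_nonneg.2 (mem_Ioi.1 hr).le) hs.le
    simp only [mem_Ici]
    linarith
  have := (tendsto_floor_right_pure_floor (-(a - b)⁻¹)).comp
    (tendsto_nhdsWithin_iff.2 ⟨hcont, hge⟩)
  refine ⟨(Nat.unpair ⌊-(a - b)⁻¹⌋.natAbs).1, (tendsto_pure.1 this).mono fun r hr => ?_⟩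
  simp only [Function.comp] at hr
  change (Nat.unpair ⌊-(r - b)⁻¹⌋.natAbs).1 = _
  rw [hr]

/-- Every open interval contains a rational of index $n\ge N$. Just to its right the digits before
$n$ are fixed, and the $n$-th can be given the value that meets the condition on a whole
subinterval. -/
lemma isMeagre_setOf_not_frequently (E : ℕ → (ℕ → ℕ) → Prop)
    (hE : ∀ n f g, (∀ j ≤ n, f j = g j) → E n f → E n g)
    (hd : ∀ n f, ∃ m, E n (Function.update f n m)) :
    IsMeagre {r | ¬ ∃ᶠ n in atTop, E n fun j => realDigit j r} := by
  have key : ∀ N, interior {r | ∃ n ≥ N, E n fun j => realDigit j r} ∈ residual ℝ := by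
    intro N
    refine residual_of_dense_open isOpen_interior (dense_iff_inter_open.2 fun I hI hne => ?_)
    have hdense : Dense (range ((↑) : ℚ → ℝ) \ (ratEnum '' Iio N)) :=
      Dense.sdiff_finite Rat.denseRange_cast ((finite_Iio N).image _)
    obtain ⟨_, hrI, ⟨q, rfl⟩, hqN⟩ := hdense.inter_open_nonempty I hI hne
    set n := Denumerable.eqv ℚ q with hn
    have hq : ratEnum n = q := by simp [ratEnum, hn]
    have hnN : N ≤ n := by
      by_contra hlt
      exact hqN ⟨n, not_le.1 hlt, hq⟩
    rw [← hq] at hrI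
    have hc : ∀ j, ∃ c, j ≠ n → ∀ᶠ r in 𝓝[>] ratEnum n, realDigit j r = c := fun j => by
      by_cases h : j = n
      · exact ⟨0, fun h' => (h' h).elim⟩
      · obtain ⟨c, hc⟩ := eventually_realDigit_const h
        exact ⟨c, fun _ => hc⟩
    choose f hf using hc
    have h1 : ∀ᶠ r in 𝓝[>] ratEnum n, ∀ j ∈ Iio n, realDigit j r = f j :=
      (eventually_all_finite (finite_Iio n)).2 fun j hj => hf j (ne_of_lt hj)
    have h2 : ∀ᶠ r in 𝓝[>] ratEnum n, r ∈ I :=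
      (hI.eventually_mem hrI).filter_mono nhdsWithin_le_nhds
    obtain ⟨u, hu, hsub⟩ := (mem_nhdsGT_iff_exists_Ioo_subset).1 (h1.and h2)
    obtain ⟨m, hm⟩ := hd n f
    obtain ⟨p, q', hp, hpq, hq', hdig⟩ :=
      exists_Ioo_realDigit_eq n m (sub_pos.2 (mem_Ioi.1 hu))
    have hsub' : Ioo p q' ⊆ Ioo (ratEnum n) u := Ioo_subset_Ioo hp.le (by linarith)
    obtain ⟨r, hr⟩ := nonempty_Ioo.2 hpq
    refine ⟨r, (hsub (hsub' hr)).2, interior_maximal (fun s hs => ?_) isOpen_Ioo hr⟩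
    refine ⟨n, hnN, hE n _ _ (fun j hj => ?_) hm⟩
    rcases hj.lt_or_eq with hj | rfl
    · rw [Function.update_of_ne hj.ne, (hsub (hsub' hs)).1 j hj]
    · rw [Function.update_self, hdig s hs]
  rw [IsMeagre]
  filter_upwards [countable_iInter_mem.2 key] with r hr
  refine not_not.2 (frequently_atTop.2 fun N => ?_)
  have hN := interior_subset (mem_iInter.1 hr N)
  exact hN

end

/-! ### Generic sequences below $\mathrm{cov}(\mathcal M)$ -/

lemma covMeager_mem : ∃ F : Set (Set ℝ), (∀ A ∈ F, IsMeagre A) ∧ ⋃₀ F = univ ∧ #F = covMeager := by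
  refine csInf_mem (s := {κ | ∃ F : Set (Set ℝ), (∀ A ∈ F, IsMeagre A) ∧ ⋃₀ F = univ ∧ #F = κ})
    ⟨_, range fun r : ℝ => {r}, ?_, ?_, rfl⟩
  · rintro _ ⟨r, rfl⟩
    refine IsNowhereDense.isMeagre ?_
    rw [IsNowhereDense, closure_singleton, interior_singleton]
  · exact eq_univ_of_forall fun r => ⟨{r}, ⟨r, rfl⟩, rfl⟩

lemma aleph0_lt_covMeager : ℵ₀ < covMeager := by
  obtain ⟨F, hF, hU, hc⟩ := covMeager_mem
  by_contra! h
  have hcount : F.Countable := by rwa [← Cardinal.le_aleph0_iff_set_countable, hc]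
  have hm : IsMeagre (univ : Set ℝ) := by
    rw [← hU, sUnion_eq_biUnion]
    exact isMeagre_biUnion hcount hF
  exact not_isMeagre_of_isOpen isOpen_univ univ_nonempty hm

/-- Fewer than `cov(𝓜)` dense conditions have a common generic sequence. -/
lemma exists_generic {I : Type} (hI : #I < covMeager) (E : I → ℕ → (ℕ → ℕ) → Prop)
    (hE : ∀ i n f g, (∀ j ≤ n, f j = g j) → E i n f → E i n g)
    (hd : ∀ i n f, ∃ m, E i n (Function.update f n m)) :
    ∃ f : ℕ → ℕ, ∀ i, ∃ᶠ n in atTop, E i n f := by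
  by_contra! hcon
  refine hI.not_ge ?_
  let A : I → Set ℝ := fun i => {r | ¬ ∃ᶠ n in atTop, E i n fun j => realDigit j r}
  have : covMeager ≤ #(range A) := by
    refine csInf_le' ⟨range A, ?_, ?_, rfl⟩
    · rintro _ ⟨i, rfl⟩
      exact isMeagre_setOf_not_frequently (E i) (hE i) (hd i)
    · refine eq_univ_of_forall fun r => ?_
      obtain ⟨i, hi⟩ := hcon fun j => realDigit j r
      exact ⟨A i, ⟨i, rfl⟩, by simpa [A] using hi⟩
  exact this.trans Cardinal.mk_range_le

/-! ### Menger and Rothberger spaces -/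

lemma IsRothbergerSpace.of_surjective {Z W : Type*} [TopologicalSpace Z] [TopologicalSpace W]
    (hZ : IsRothbergerSpace Z) {f : Z → W} (hf : Continuous f) (hs : Function.Surjective f) :
    IsRothbergerSpace W := by
  intro 𝒰 h𝒰
  obtain ⟨V, hV, hcov⟩ := hZ (fun n => preimage f '' 𝒰 n) fun n => by
    refine ⟨?_, eq_univ_of_forall fun z => ?_⟩
    · rintro _ ⟨U, hU, rfl⟩
      exact ((h𝒰 n).1 U hU).preimage hf
    · obtain ⟨U, hU, hz⟩ := (h𝒰 n).2.symm.subset (mem_univ (f z))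
      exact ⟨_, ⟨U, hU, rfl⟩, hz⟩
  choose U hU hUV using hV
  refine ⟨U, hU, eq_univ_of_forall fun w => ?_⟩
  obtain ⟨z, rfl⟩ := hs w
  obtain ⟨n, hn⟩ := mem_iUnion.1 (hcov.symm.subset (mem_univ z))
  rw [← hUV] at hn
  exact mem_iUnion.2 ⟨n, hn⟩

lemma IsMengerSpace.of_surjective {Z W : Type*} [TopologicalSpace Z] [TopologicalSpace W]
    (hZ : IsMengerSpace Z) {f : Z → W} (hf : Continuous f) (hs : Function.Surjective f) :
    IsMengerSpace W := by
  intro 𝒰 h𝒰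
  obtain ⟨ℱ, hℱ, hcov⟩ := hZ (fun n => preimage f '' 𝒰 n) fun n => by
    refine ⟨?_, eq_univ_of_forall fun z => ?_⟩
    · rintro _ ⟨U, hU, rfl⟩
      exact ((h𝒰 n).1 U hU).preimage hf
    · obtain ⟨U, hU, hz⟩ := (h𝒰 n).2.symm.subset (mem_univ (f z))
      exact ⟨_, ⟨U, hU, rfl⟩, hz⟩
  have hex : ∀ n, ∃ 𝒢 ⊆ 𝒰 n, 𝒢.Finite ∧ preimage f '' 𝒢 = ℱ n := fun n =>
    exists_subset_image_finite_and.1 ⟨ℱ n, (hℱ n).1, (hℱ n).2, rfl⟩ |>.imp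
      fun 𝒢 h => ⟨h.1, h.2.1, h.2.2.symm⟩
  choose 𝒢 h𝒢 hfin him using hex
  refine ⟨𝒢, fun n => ⟨h𝒢 n, hfin n⟩, eq_univ_of_forall fun w => ?_⟩
  obtain ⟨z, rfl⟩ := hs w
  obtain ⟨n, hn⟩ := mem_iUnion.1 (hcov.symm.subset (mem_univ z))
  obtain ⟨V, hV, hz⟩ := hn
  rw [← him n] at hV
  obtain ⟨U, hU, rfl⟩ := hV
  exact mem_iUnion.2 ⟨n, U, hU, hz⟩

/-- In a Menger space, a sequence of decreasing sequences of closed sets with empty intersections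
can be bounded. -/
lemma IsMengerSpace.exists_frequently_notMem {Z : Type*} [TopologicalSpace Z]
    (hZ : IsMengerSpace Z) (C : ℕ → ℕ → Set Z) (hC : ∀ n k, IsClosed (C n k))
    (hanti : ∀ n, Antitone (C n)) (hempty : ∀ n z, ∃ k, z ∉ C n k) :
    ∃ g : ℕ → ℕ, ∀ z, ∃ᶠ n in atTop, z ∉ C n (g n) := by
  have key : ∀ N, ∃ g : ℕ → ℕ, ∀ z, ∃ n, z ∉ C (n + N) (g n) := by
    intro N
    obtain ⟨ℱ, hℱ, hcov⟩ := hZ (fun n => range fun k => (C (n + N) k)ᶜ) fun n => by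
      refine ⟨?_, eq_univ_of_forall fun z => ?_⟩
      · rintro _ ⟨k, rfl⟩
        exact (hC _ _).isOpen_compl
      · obtain ⟨k, hk⟩ := hempty (n + N) z
        exact ⟨_, ⟨k, rfl⟩, hk⟩
    have hb : ∀ n, ∃ g, ∀ U ∈ ℱ n, U ⊆ (C (n + N) g)ᶜ := by
      intro n
      have hk : ∀ U : Set Z, ∃ k, U ∈ ℱ n → (C (n + N) k)ᶜ = U := fun U => by
        by_cases hU : U ∈ ℱ n
        · obtain ⟨k, hk⟩ := (hℱ n).1 hU
          exact ⟨k, fun _ => hk⟩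
        · exact ⟨0, fun h => (hU h).elim⟩
      choose k hk using hk
      obtain ⟨g, hg⟩ := ((hℱ n).2.image k).bddAbove
      refine ⟨g, fun U hU => ?_⟩
      rw [← hk U hU]
      exact compl_subset_compl.2 (hanti _ (hg ⟨U, hU, rfl⟩))
    choose g hg using hb
    refine ⟨g, fun z => ?_⟩
    obtain ⟨n, U, hU, hz⟩ := mem_iUnion.1 (hcov.symm.subset (mem_univ z))
    exact ⟨n, hg n U hU hz⟩
  choose g hg using key
  -- The diagonal maximum dominates each tail solution $g_N$ from $N$ on, turning one good $n$ per
  -- tail into infinitely many.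
  refine ⟨fun n => (Finset.range (n + 1)).sup fun N => g N (n - N), fun z =>
    frequently_atTop.2 fun N => ?_⟩
  obtain ⟨n, hn⟩ := hg N z
  refine ⟨n + N, Nat.le_add_left _ _, fun h => hn (hanti _ ?_ h)⟩
  have := Finset.le_sup (f := fun M => g M (n + N - M))
    (Finset.mem_range.2 (show N < n + N + 1 by omega))
  simpa using this

/-- A set of cardinality less than `cov(𝓜)` can be covered by choosing one element of each
cover. -/
lemma exists_selection_of_mk_lt {Z : Type} [TopologicalSpace Z] [SecondCountableTopology Z]
    [Nonempty Z] {S : Set Z} (hS : #S < covMeager) (𝒰 : ℕ → Set (Set Z))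
    (h𝒰 : ∀ n, IsOpenCovering Z (𝒰 n)) : ∃ U : ℕ → Set Z, (∀ n, U n ∈ 𝒰 n) ∧ S ⊆ ⋃ n, U n := by
  have hV : ∀ n, ∃ V : ℕ → Set Z, (∀ k, V k ∈ 𝒰 n) ∧ ∀ z, ∃ k, z ∈ V k := by
    intro n
    obtain ⟨T, hT, hsub, hcov⟩ := TopologicalSpace.isOpen_sUnion_countable (𝒰 n) (h𝒰 n).1
    rw [(h𝒰 n).2] at hcov
    have hne : T.Nonempty := by
      obtain ⟨U, hU, -⟩ := hcov.symm.subset (mem_univ (Classical.arbitrary Z))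
      exact ⟨U, hU⟩
    obtain ⟨V, rfl⟩ := hT.exists_eq_range hne
    refine ⟨V, fun k => hsub ⟨k, rfl⟩, fun z => ?_⟩
    obtain ⟨_, ⟨k, rfl⟩, hz⟩ := hcov.symm.subset (mem_univ z)
    exact ⟨k, hz⟩
  choose V hV hVcov using hV
  obtain ⟨f, hf⟩ := exists_generic hS (fun z n f => (z : Z) ∈ V n (f n))
    (fun z n f g h hz => by rwa [h n le_rfl] at hz)
    (fun z n f => (hVcov n z).imp fun k hk => by simpa using hk)
  refine ⟨fun n => V n (f n), fun n => hV _ _, fun z hz => ?_⟩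
  obtain ⟨n, hn⟩ := (hf ⟨z, hz⟩).exists
  exact mem_iUnion.2 ⟨n, hn⟩

/-- A space that is `cov(𝓜)`-concentrated on a countable set is Rothberger. -/
lemma isRothbergerSpace_of_concentrated {Z : Type} [TopologicalSpace Z] [SecondCountableTopology Z]
    (q : ℕ → Z) (hq : ∀ U : Set Z, IsOpen U → (∀ n, q n ∈ U) → #(Uᶜ : Set Z) < covMeager) :
    IsRothbergerSpace Z := by
  intro 𝒰 h𝒰
  have : Nonempty Z := ⟨q 0⟩
  -- Even-indexed covers take care of the countable set, odd-indexed ones of the few points left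
  -- over.
  have hex : ∀ n, ∃ U ∈ 𝒰 (2 * n), q n ∈ U := fun n =>
    (h𝒰 (2 * n)).2.symm.subset (mem_univ (q n))
  choose U hU hqU using hex
  have hopen : IsOpen (⋃ n, U n) := isOpen_iUnion fun n => (h𝒰 _).1 _ (hU n)
  obtain ⟨V, hV, hcov⟩ := exists_selection_of_mk_lt
    (hq _ hopen fun n => mem_iUnion.2 ⟨n, hqU n⟩) (fun n => 𝒰 (2 * n + 1)) fun n => h𝒰 _
  refine ⟨fun n => if n % 2 = 0 then U (n / 2) else V (n / 2), fun n => ?_,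
    eq_univ_of_forall fun z => ?_⟩
  · by_cases h : n % 2 = 0
    · have h2 := hU (n / 2)
      rw [show 2 * (n / 2) = n by omega] at h2
      simpa [h] using h2
    · have h2 := hV (n / 2)
      simp only [show 2 * (n / 2) + 1 = n by omega] at h2
      simpa [h] using h2
  · by_cases hz : z ∈ ⋃ n, U n
    · obtain ⟨n, hn⟩ := mem_iUnion.1 hz
      refine mem_iUnion.2 ⟨2 * n, ?_⟩
      simpa using hn
    · obtain ⟨n, hn⟩ := mem_iUnion.1 (hcov hz)
      refine mem_iUnion.2 ⟨2 * n + 1, ?_⟩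
      simpa [show (2 * n + 1) / 2 = n by omega] using hn

/-! ### Slow binary sequences built from blocks -/

/-- The starting points of the blocks coded by `f`; blocks grow at least as fast as `a`. -/
def blockStart (a f : ℕ → ℕ) : ℕ → ℕ
  | 0 => 0
  | n + 1 => blockStart a f n + a (blockStart a f n) + 1 + f n

lemma blockStart_succ (a f : ℕ → ℕ) (n : ℕ) :
    blockStart a f (n + 1) = blockStart a f n + a (blockStart a f n) + 1 + f n := rfl

lemma blockStart_strictMono (a f : ℕ → ℕ) : StrictMono (blockStart a f) :=
  strictMono_nat_of_lt_succ fun n => by rw [blockStart_succ]; omega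

lemma blockStart_congr (a : ℕ → ℕ) {f g : ℕ → ℕ} {n : ℕ} (h : ∀ j < n, f j = g j) :
    blockStart a f n = blockStart a g n := by
  induction n with
  | zero => rfl
  | succ n ih =>
    rw [blockStart_succ, blockStart_succ, ih fun j hj => h j (by omega), h n (by omega)]

lemma exists_lt_blockStart_succ (a f : ℕ → ℕ) (j : ℕ) : ∃ n, j < blockStart a f (n + 1) :=
  ⟨j, (blockStart_strictMono a f).le_apply⟩

/-- The binary sequence that on the `n`-th block is constantly the parity of `f n`. -/
def blockSeq (a f : ℕ → ℕ) (j : ℕ) : Bool :=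
  (f (Nat.find (exists_lt_blockStart_succ a f j))).bodd

lemma blockSeq_eq {a f : ℕ → ℕ} {n j : ℕ} (h1 : blockStart a f n ≤ j)
    (h2 : j < blockStart a f (n + 1)) : blockSeq a f j = (f n).bodd := by
  have : Nat.find (exists_lt_blockStart_succ a f j) = n := by
    rw [Nat.find_eq_iff]
    refine ⟨h2, fun m hm => not_lt.2 (le_trans ?_ h1)⟩
    exact (blockStart_strictMono a f).monotone hm
  rw [blockSeq, this]

lemma exists_blockStart_of_blockSeq_ne {a f : ℕ → ℕ} {j : ℕ}
    (h : blockSeq a f j ≠ blockSeq a f (j + 1)) : ∃ n, j + 1 = blockStart a f (n + 1) := by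
  have hlt := Nat.find_spec (exists_lt_blockStart_succ a f j)
  set n := Nat.find (exists_lt_blockStart_succ a f j) with hn
  refine ⟨n, le_antisymm hlt (not_lt.1 fun hlt' => h ?_)⟩
  have hle : blockStart a f n ≤ j := by
    rcases Nat.eq_zero_or_pos n with h0 | h0
    · rw [h0]; exact Nat.zero_le _
    · obtain ⟨m, hm⟩ := Nat.exists_eq_succ_of_ne_zero h0.ne'
      have := Nat.find_min (exists_lt_blockStart_succ a f j) (m := m) (by omega)
      rw [hm]; exact not_lt.1 this
  rw [blockSeq_eq hle hlt, blockSeq_eq (hle.trans (Nat.le_succ j)) hlt']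

/-- Two changes of value of `x` occur in the interval from `n` to `k`. -/
def HasTwoChanges (x : ℕ → Bool) (n k : ℕ) : Prop :=
  ∃ i j, n ≤ i ∧ i < j ∧ j ≤ k ∧ x i ≠ x (i + 1) ∧ x j ≠ x (j + 1)

/-- Changes occur only at block boundaries, and a block starting at $s>n$ is longer than $a(s)\ge
a(n)$. -/
lemma not_hasTwoChanges_blockSeq {a : ℕ → ℕ} (ha : Monotone a) (f : ℕ → ℕ) (n : ℕ) :
    ¬ HasTwoChanges (blockSeq a f) n (a n) := by
  rintro ⟨i, j, hni, hij, hj, h1, h2⟩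
  obtain ⟨p, hp⟩ := exists_blockStart_of_blockSeq_ne h1
  obtain ⟨q, hq⟩ := exists_blockStart_of_blockSeq_ne h2
  have hpq : p + 1 < q + 1 := (blockStart_strictMono a f).lt_iff_lt.1 (by omega)
  have h3 : blockStart a f (p + 1 + 1) ≤ blockStart a f (q + 1) :=
    (blockStart_strictMono a f).monotone hpq
  rw [blockStart_succ, ← hp] at h3
  have h4 : a n ≤ a (i + 1) := ha (by omega)
  omega

lemma hasTwoChanges_of_frequently {x : ℕ → Bool} (h : ∀ c, ∃ᶠ n in atTop, x n = c) (n : ℕ) :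
    ∃ k, HasTwoChanges x n k := by
  have hchange : ∀ m, ∃ i ≥ m, x i ≠ x (i + 1) := by
    intro m
    by_contra! hcon
    have hconst : ∀ i ≥ m, x i = x m := fun i hi => by
      induction i, hi using Nat.le_induction with
      | base => rfl
      | succ i hi ih => rw [← hcon i hi, ih]
    obtain ⟨i, hi, hx⟩ := frequently_atTop.1 (h (!x m)) m
    rw [hconst i hi] at hx
    simp at hx
  obtain ⟨i, hi, hxi⟩ := hchange n
  obtain ⟨j, hj, hxj⟩ := hchange (i + 1)
  exact ⟨j, i, j, hi, hj, le_rfl, hxi, hxj⟩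

/-- Given fewer than `cov(𝓜)` functions `b i`, there is a binary sequence that changes slowly
(compared to `a`) but has, for each `i`, infinitely many constant intervals `[n, b i n]` of both
values. -/
lemma exists_slow_sequence {I : Type} (hI : #I < covMeager) {a : ℕ → ℕ} (ha : Monotone a)
    (b : I → ℕ → ℕ) : ∃ x : ℕ → Bool, (∀ n, ¬ HasTwoChanges x n (a n)) ∧
      ∀ i c, ∃ᶠ n in atTop, ∀ j ∈ Icc n (b i n), x j = c := by
  have hIB : #(I × Bool) < covMeager := by
    rw [Cardinal.mk_prod, Cardinal.lift_id, Cardinal.lift_id]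
    exact Cardinal.mul_lt_of_lt aleph0_lt_covMeager.le hI
      ((Cardinal.lt_aleph0_of_finite _).trans aleph0_lt_covMeager)
  obtain ⟨f, hf⟩ := exists_generic hIB
    (fun p n f => (f n).bodd = p.2 ∧ b p.1 (blockStart a f n) ≤ f n)
    (fun p n f g h hp => by
      rwa [h n le_rfl, blockStart_congr a fun j hj => h j hj.le] at hp)
    (fun p n f => by
      have hs : ∀ m, blockStart a (Function.update f n m) n = blockStart a f n := fun m =>
        blockStart_congr a fun j hj => Function.update_of_ne hj.ne _ _
      -- The last bit sets the value on the block; the doubled part makes the block long enough.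
      refine ⟨Nat.bit p.2 (b p.1 (blockStart a f n)), ?_, ?_⟩
      · simp
      · rw [hs, Function.update_self, Nat.bit_val]; omega)
  refine ⟨blockSeq a f, not_hasTwoChanges_blockSeq ha f, fun i c => ?_⟩
  refine frequently_atTop.2 fun N => ?_
  obtain ⟨n, hn, hc, hb⟩ := frequently_atTop.1 (hf (i, c)) N
  refine ⟨blockStart a f n, hn.trans (blockStart_strictMono a f).le_apply, fun j hj => ?_⟩
  rw [blockSeq_eq hj.1 ?_, hc]
  rw [blockStart_succ]
  have := hj.2
  dsimp only at hb
  omega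

/-! ### Concentration on the finite sets -/

/-- The characteristic sequence of a finite set of natural numbers. -/
def finsetSeq (s : Finset ℕ) (n : ℕ) : Bool := decide (n ∈ s)

lemma isOpen_setOf_of_discrete {Z W : Type*} [TopologicalSpace Z] [TopologicalSpace W]
    [DiscreteTopology W] {f : Z → W} (hf : Continuous f) (p : W → Prop) :
    IsOpen {z | p (f z)} :=
  (isOpen_discrete {w | p w}).preimage hf

/-- Every point of the compact set $K$ takes the value `true` beyond $n$, so finitely many of the
increasing open sets "a `true` in $[n,b]$" suffice. -/
lemma exists_bound_of_finsetSeq_notMem {K : Set (ℕ → Bool)} (hK : IsClosed K)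
    (h : ∀ s, finsetSeq s ∉ K) :
    ∃ b : ℕ → ℕ, ∀ n, ∀ x ∈ K, ∃ j ∈ Icc n (b n), x j = true := by
  have key : ∀ n, ∃ b, ∀ x ∈ K, ∃ j ∈ Icc n b, x j = true := by
    intro n
    have hcov : K ⊆ ⋃ b : ℕ, ⋃ j ∈ Icc n b, {x : ℕ → Bool | x j = true} := by
      intro x hx
      by_contra hcon
      refine h ((Finset.range n).filter fun j => x j = true) ?_
      convert hx using 1
      funext j
      by_cases hj : j < n
      · simp [finsetSeq, hj]
      · have : x j ≠ true := fun hxj => hcon <| mem_iUnion.2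
          ⟨j, mem_iUnion₂.2 ⟨j, ⟨not_lt.1 hj, le_rfl⟩, hxj⟩⟩
        simp [finsetSeq, hj, this]
    obtain ⟨b, hb⟩ := hK.isCompact.elim_directed_cover _
      (fun b => isOpen_biUnion fun j _ =>
        isOpen_setOf_of_discrete (f := fun y : ℕ → Bool => y j) (by fun_prop) (· = true)) hcov
      (Monotone.directed_le fun b c hbc => biUnion_subset_biUnion_left (Icc_subset_Icc_right hbc))
    refine ⟨b, fun x hx => ?_⟩
    obtain ⟨j, hj, hxj⟩ := mem_iUnion₂.1 (hb hx)
    exact ⟨j, hj, hxj⟩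
  choose b hb using key
  exact ⟨b, hb⟩

/-- A sequence of points indexed by a well-ordered set with small initial segments that escapes
the members of a dominating family, together with the finite sets, is Rothberger. -/
lemma isRothbergerSpace_range_union_range_finsetSeq {ι : Type} [LinearOrder ι]
    (hι : ∀ β : ι, #(Iic β) < covMeager) (d : ι → ℕ → ℕ)
    (hd : ∀ g : ℕ → ℕ, ∃ β, ∀ᶠ n in atTop, g n ≤ d β n) (x : ι → ℕ → Bool)
    (hx : ∀ α, ∀ β ≤ α, ∃ᶠ n in atTop, ∀ j ∈ Icc n (d β n), x α j = false) :
    IsRothbergerSpace ↥(range x ∪ range finsetSeq) := by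
  obtain ⟨s, hs⟩ := exists_surjective_nat (Finset ℕ)
  refine isRothbergerSpace_of_concentrated (fun n => ⟨finsetSeq (s n), Or.inr ⟨_, rfl⟩⟩) ?_
  rintro _ ⟨V, hV, rfl⟩ hsV
  obtain ⟨b, hb⟩ := exists_bound_of_finsetSeq_notMem hV.isClosed_compl fun t => by
    obtain ⟨n, rfl⟩ := hs t
    exact not_not.2 (hsV n)
  obtain ⟨β, hβ⟩ := hd b
  have hsub : Subtype.val '' (Subtype.val ⁻¹' V : Set ↥(range x ∪ range finsetSeq))ᶜ ⊆
      x '' Iic β := by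
    rintro _ ⟨⟨_, ⟨α, rfl⟩ | ⟨t, rfl⟩⟩, hz, rfl⟩
    · refine ⟨α, mem_Iic.2 (not_lt.1 fun hlt => ?_), rfl⟩
      obtain ⟨n, hn, hle⟩ := ((hx α β hlt.le).and_eventually hβ).exists
      obtain ⟨j, hj, hxj⟩ := hb n (x α) hz
      rw [hn j ⟨hj.1, hj.2.trans hle⟩] at hxj
      exact absurd hxj (by decide)
    · obtain ⟨n, rfl⟩ := hs t
      exact (hz (hsV n)).elim
  rw [← Cardinal.mk_image_eq Subtype.val_injective]
  exact (Cardinal.mk_le_mk_of_subset hsub).trans_lt (Cardinal.mk_image_le.trans_lt (hι β))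

/-! ### The product is not Menger -/

lemma isClosed_setOf_not_hasTwoChanges (n k : ℕ) :
    IsClosed {x : ℕ → Bool | ¬ HasTwoChanges x n k} := by
  have hne : ∀ i, IsOpen {x : ℕ → Bool | x i ≠ x (i + 1)} := fun i =>
    isOpen_setOf_of_discrete (f := fun x : ℕ → Bool => (x i, x (i + 1))) (by fun_prop)
      fun p => p.1 ≠ p.2
  have : IsOpen {x : ℕ → Bool | HasTwoChanges x n k} := by
    have heq : {x : ℕ → Bool | HasTwoChanges x n k} =
        ⋃ (i) (j) (_ : n ≤ i ∧ i < j ∧ j ≤ k),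
          {x : ℕ → Bool | x i ≠ x (i + 1)} ∩ {x | x j ≠ x (j + 1)} := by
      ext x
      simp only [mem_iUnion]
      constructor
      · rintro ⟨i, j, h1, h2, h3, h4, h5⟩
        exact ⟨i, j, ⟨h1, h2, h3⟩, h4, h5⟩
      · rintro ⟨i, j, ⟨h1, h2, h3⟩, h4, h5⟩
        exact ⟨i, j, h1, h2, h3, h4, h5⟩
    rw [heq]
    exact isOpen_iUnion fun i => isOpen_iUnion fun j => isOpen_iUnion fun _ =>
      (hne i).inter (hne j)
  exact this.isClosed_compl

lemma not_isMengerSpace_prod {ι : Type*} (d : ι → ℕ → ℕ)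
    (hd : ∀ g : ℕ → ℕ, ∃ β, ∀ᶠ n in atTop, g n ≤ d β n) (x : ι → ℕ → Bool)
    (hslow : ∀ α n, ¬ HasTwoChanges (x α) n (d α n))
    (hx : ∀ α c, ∃ᶠ n in atTop, x α n = c) :
    ¬ IsMengerSpace (↥(range x ∪ range finsetSeq) ×
      ↥(range (fun α n => !x α n) ∪ range finsetSeq)) := by
  intro hM
  have hfin : ∀ s, ∀ᶠ n in atTop, finsetSeq s n = false := fun s => by
    obtain ⟨N, hN⟩ := s.bddAbove
    filter_upwards [eventually_gt_atTop N] with n hn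
    simpa [finsetSeq] using fun h => (hN h).not_gt hn
  obtain ⟨g, hg⟩ := hM.exists_frequently_notMem
    (fun n k => {z | (z.2 : ℕ → Bool) = fun m => !(z.1 : ℕ → Bool) m} ∩
      {z | ¬ HasTwoChanges z.1 n k})
    (fun n k => by
      refine IsClosed.inter (isClosed_eq (by fun_prop) ?_)
        ((isClosed_setOf_not_hasTwoChanges n k).preimage (by fun_prop))
      refine continuous_pi fun m => (continuous_of_discreteTopology (f := not)).comp ?_
      exact (continuous_apply m).comp (by fun_prop))
    (fun n k l hkl z hz => ⟨hz.1, fun ⟨i, j, h1, h2, h3, h4⟩ =>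
      hz.2 ⟨i, j, h1, h2, h3.trans hkl, h4⟩⟩)
    (by
      rintro n ⟨⟨u, hu⟩, ⟨v, hv⟩⟩
      by_contra! hcon
      have hvu : v = fun m => !u m := (hcon 0).1
      -- Two finite sets are not complementary, so at least one coordinate of the pair comes from
      -- some $x_\alpha$, and then `u` is $x_\alpha$.
      have hmem : u ∈ range x := by
        rcases hu with hu | ⟨s, rfl⟩
        · exact hu
        · rcases hv with ⟨α, hα⟩ | ⟨t, rfl⟩
          · refine ⟨α, funext fun m => ?_⟩
            have := congrFun (hα.trans hvu) m
            simpa using this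
          · obtain ⟨m, h1, h2⟩ := ((hfin s).and (hfin t)).exists
            have := congrFun hvu m
            simp [h1, h2] at this
      obtain ⟨α, rfl⟩ := hmem
      obtain ⟨k, hk⟩ := hasTwoChanges_of_frequently (hx α) n
      exact (hcon k).2 hk)
  obtain ⟨α, hα⟩ := hd g
  obtain ⟨n, hn, hle⟩ := ((hg ⟨⟨x α, Or.inl ⟨α, rfl⟩⟩, ⟨fun n => !x α n, Or.inl ⟨α, rfl⟩⟩⟩
    ).and_eventually hα).exists
  exact hn ⟨rfl, fun ⟨i, j, h1, h2, h3, h4⟩ => hslow α n ⟨i, j, h1, h2, h3.trans hle, h4⟩⟩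

/-! ### Dominating families and the conclusion -/

lemma InfiniteNatSet.enum_strictMono (a : InfiniteNatSet) : StrictMono a.enum :=
  Nat.nth_strictMono a.2

lemma exists_infiniteNatSet_le_enum (g : ℕ → ℕ) : ∃ a : InfiniteNatSet, ∀ n, g n ≤ a.enum n := by
  have hs : StrictMono (blockStart 0 g) := blockStart_strictMono 0 g
  have hs' : StrictMono fun n => blockStart 0 g (n + 1) := hs.comp fun _ _ h => Nat.succ_lt_succ h
  let a : InfiniteNatSet := ⟨range fun n => blockStart 0 g (n + 1),
    infinite_range_of_injective hs'.injective⟩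
  have ha : a.enum = fun n => blockStart 0 g (n + 1) :=
    (StrictMono.range_inj a.enum_strictMono hs').1 (Nat.range_nth_of_infinite a.2)
  refine ⟨a, fun n => ?_⟩
  rw [ha]
  simp only [blockStart_succ]
  omega

lemma IsDominating.exists_eventually_le {D : Set InfiniteNatSet} (hD : IsDominating D)
    (g : ℕ → ℕ) : ∃ x ∈ D, ∀ᶠ n in atTop, g n ≤ x.enum n := by
  obtain ⟨a, ha⟩ := exists_infiniteNatSet_le_enum g
  obtain ⟨x, hx, hax⟩ := hD a
  refine ⟨x, hx, ?_⟩
  have : ∀ᶠ n in atTop, n ∉ {n | x.enum n < a.enum n} := by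
    rw [← Nat.cofinite_eq_atTop]
    exact hax.compl_mem_cofinite
  filter_upwards [this] with n hn
  exact (ha n).trans (not_lt.1 hn)

lemma exists_isDominating_mk_eq : ∃ D, IsDominating D ∧ #D = dominatingNumber :=
  csInf_mem (s := {κ | ∃ D : Set InfiniteNatSet, IsDominating D ∧ #D = κ})
    ⟨_, univ, fun a => ⟨a, mem_univ a, by simp [InfiniteNatSet.LeStar]⟩, rfl⟩

theorem mainTheorem12 (h : covMeager = dominatingNumber) :
    ∃ X Y : Set ℝ, IsRothbergerSpace ↥X ∧ IsRothbergerSpace ↥Y ∧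
      ¬ IsMengerSpace (↥X × ↥Y) := by
  obtain ⟨D, hD, hcard⟩ := exists_isDominating_mk_eq
  have hι : #dominatingNumber.ord.ToType = dominatingNumber := by simp
  obtain ⟨e⟩ := Cardinal.eq.1 (hι.trans hcard.symm)
  -- The hypothesis $\mathrm{cov}(\mathcal M)=\mathfrak d$ enters here.
  have hIic : ∀ β : dominatingNumber.ord.ToType, #(Iic β) < covMeager := fun β => by
    rw [h]
    refine (Cardinal.mk_Iic_lt β (by simp) ?_).trans_eq hι
    rw [hι, ← h]
    exact aleph0_lt_covMeager.le
  let d : dominatingNumber.ord.ToType → ℕ → ℕ := fun α => (e α).1.enum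
  have hd : ∀ g : ℕ → ℕ, ∃ β, ∀ᶠ n in atTop, g n ≤ d β n := fun g => by
    obtain ⟨y, hy, hgy⟩ := hD.exists_eventually_le g
    exact ⟨e.symm ⟨y, hy⟩, by simpa [d] using hgy⟩
  choose x hslow hx using fun α => exists_slow_sequence (hIic α)
    (e α).1.enum_strictMono.monotone fun β : Iic α => d β
  have hval : ∀ α c, ∃ᶠ n in atTop, x α n = c := fun α c =>
    (hx α ⟨α, mem_Iic.2 le_rfl⟩ c).mono fun n hn => hn n ⟨le_rfl, (e α).1.enum_strictMono.le_apply⟩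
  -- The Cantor set carries the construction into the real line.
  let φ : (ℕ → Bool) → ℝ := Subtype.val ∘ cantorSetHomeomorphNatToBool.symm
  have hφ : Topology.IsEmbedding φ :=
    Topology.IsEmbedding.subtypeVal.comp cantorSetHomeomorphNatToBool.symm.isEmbedding
  let A : Set (ℕ → Bool) := range x ∪ range finsetSeq
  let B : Set (ℕ → Bool) := range (fun α n => !x α n) ∪ range finsetSeq
  have hA : IsRothbergerSpace A := isRothbergerSpace_range_union_range_finsetSeq hIic d hd x
    fun α β hβ => hx α ⟨β, hβ⟩ false
  have hB : IsRothbergerSpace B := isRothbergerSpace_range_union_range_finsetSeq hIic d hd _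
    fun α β hβ => (hx α ⟨β, hβ⟩ true).mono fun n hn j hj => by simp [hn j hj]
  let eA := hφ.homeomorphImage A
  let eB := hφ.homeomorphImage B
  refine ⟨φ '' A, φ '' B, hA.of_surjective eA.continuous eA.surjective,
    hB.of_surjective eB.continuous eB.surjective, fun hM => ?_⟩
  exact not_isMengerSpace_prod d hd x hslow hval
    (hM.of_surjective (eA.prodCongr eB).symm.continuous (eA.prodCongr eB).symm.surjective)
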